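/- For every infinite cardinal $\kappa$ there is a Noetherian ring, in fact a Noetherian (commutative) integral domain, of cardinality $\kappa$ whose additive group is free abelian. Moreover, such a domain is given explicitly as follows. Let $X$ be any set of distinct variables with $|X|=\kappa$, let $\mathbb{Z}[X]$ be the polynomial ring over $\mathbb{Z}$ in the variables $X$, and let $\mathbb{Z}(X)$ be its field of fractions. Call $q\in\mathbb{Z}[X]$ primitive if the only integers dividing $q$ in $\mathbb{Z}[X]$ are $1$ and $-1$. Let $R_X$ be the additive subgroup of $\mathbb{Z}(X)$ generated by $$\{\,p/q : p,q\in\mathbb{Z}[X],\ q \text{ primitive}\,\}.$$ This set is itself closed under addition, negation and multiplication and contains $1$, so $R_X$ equals it and is a subring of $\mathbb{Z}(X)$. Then $R_X$ is a Noetherian integral domain of cardinality $\kappa$, and its additive group is free abelian. -/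

import Mathlib

universe u

namespace FreeNoetherian

/-- A polynomial over `ℤ` is primitive if it is not divisible (non-trivially) by any integer:
every integer dividing it is `1` or `-1`. In particular `0` is not primitive. -/
def IsPrimitive {X : Type*} (q : MvPolynomial X ℤ) : Prop :=
  ∀ n : ℤ, MvPolynomial.C n ∣ q → IsUnit n

theorem IsPrimitive.ne_zero {X : Type*} {q : MvPolynomial X ℤ} (hq : IsPrimitive q) : q ≠ 0 := by
  rintro rfl
  exact not_isUnit_zero (hq 0 (dvd_zero _))

theorem isPrimitive_one {X : Type*} : IsPrimitive (1 : MvPolynomial X ℤ) := by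
  intro n hn
  have h := map_dvd (MvPolynomial.constantCoeff (R := ℤ) (σ := X)) hn
  simp only [MvPolynomial.constantCoeff_C, map_one] at h
  exact isUnit_of_dvd_one h

/-- Gauss's lemma: a product of primitive polynomials is primitive. -/
theorem IsPrimitive.mul {X : Type*} {p q : MvPolynomial X ℤ}
    (hp : IsPrimitive p) (hq : IsPrimitive q) : IsPrimitive (p * q) := by
  intro n hn
  by_contra hu
  by_cases h0 : n = 0
  · subst h0
    rw [map_zero, zero_dvd_iff] at hn
    exact mul_ne_zero hp.ne_zero hq.ne_zero hn
  · obtain ⟨r, hr, hrn⟩ := WfDvdMonoid.exists_irreducible_factor hu h0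
    have hC : Prime (MvPolynomial.C r : MvPolynomial X ℤ) :=
      (MvPolynomial.prime_C_iff X).2 hr.prime
    rcases hC.dvd_or_dvd ((map_dvd MvPolynomial.C hrn).trans hn) with h | h
    · exact hr.not_isUnit (hp r h)
    · exact hr.not_isUnit (hq r h)

/-- The set of fractions `p / q` in the field of fractions `ℤ(X)` of `ℤ[X]`, where `p` and `q` are
polynomials over `ℤ` in the variables `X` and `q` is primitive. -/
def primitiveFractions (X : Type*) : Set (FractionRing (MvPolynomial X ℤ)) :=
  {z | ∃ p q : MvPolynomial X ℤ, IsPrimitive q ∧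
    z = algebraMap (MvPolynomial X ℤ) (FractionRing (MvPolynomial X ℤ)) p /
      algebraMap (MvPolynomial X ℤ) (FractionRing (MvPolynomial X ℤ)) q}

theorem algebraMap_ne_zero {X : Type*} {q : MvPolynomial X ℤ} (hq : IsPrimitive q) :
    algebraMap (MvPolynomial X ℤ) (FractionRing (MvPolynomial X ℤ)) q ≠ 0 :=
  (map_ne_zero_iff _ (IsFractionRing.injective (MvPolynomial X ℤ)
    (FractionRing (MvPolynomial X ℤ)))).2 hq.ne_zero

/-- The ring `R_X`: the set of the fractions `p / q` with `q` primitive, which is a subring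
of `ℤ(X)`. -/
def RX (X : Type*) : Subring (FractionRing (MvPolynomial X ℤ)) where
  carrier := primitiveFractions X
  zero_mem' := ⟨0, 1, isPrimitive_one, by simp⟩
  one_mem' := ⟨1, 1, isPrimitive_one, by simp⟩
  add_mem' := by
    rintro _ _ ⟨p, q, hq, rfl⟩ ⟨p', q', hq', rfl⟩
    refine ⟨p * q' + q * p', q * q', hq.mul hq', ?_⟩
    rw [div_add_div _ _ (algebraMap_ne_zero hq) (algebraMap_ne_zero hq')]
    simp only [map_add, map_mul]
  mul_mem' := by
    rintro _ _ ⟨p, q, hq, rfl⟩ ⟨p', q', hq', rfl⟩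
    refine ⟨p * p', q * q', hq.mul hq', ?_⟩
    rw [div_mul_div_comm, map_mul, map_mul]
  neg_mem' := by
    rintro _ ⟨p, q, hq, rfl⟩
    exact ⟨-p, q, hq, by rw [map_neg, neg_div]⟩

/-- `R_X` is the additive subgroup of `ℤ(X)` generated by the fractions `p / q` with `q`
primitive. -/
theorem RX_toAddSubgroup (X : Type*) :
    (RX X).toAddSubgroup = AddSubgroup.closure (primitiveFractions X) :=
  le_antisymm (fun _ hz => AddSubgroup.subset_closure hz)
    ((AddSubgroup.closure_le _).2 fun _ hz => hz)

end FreeNoetherian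

/-!
Every element of `R_X` is an integer times a unit, by Gauss's lemma, so each ideal is generated by an
integer and `R_X` is a principal ideal domain. The substance is the freeness of its additive group.

For a set `W` of variables let `primFrac W` be the subgroup of fractions involving variables in `W`
only. The claim proved is stronger: if `Y₁, …, Yₙ` and `W` contain a common variable `x₀` and `S` is
the sum of the groups `primFrac Yᵢ`, then `(S + primFrac W) / S` is free (`freeOver_primFrac`, by
induction on the cardinality of `W`).

* If `W` is uncountable, it is a continuous increasing union of sets of smaller cardinality. Each
  quotient of the resulting filtration is again of the form `(S' + primFrac W') / S'`, where `S'` has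
  one more summand, and a well-ordered filtration with free quotients has a free union
  (`freeOver_of_filtration`).
* If `W` is countable, Pontryagin's criterion (`freeOver_of_countable`) applies: the quotient is
  torsion-free (`mem_sumPrimFrac_of_smul_mem`), and its finitely generated subgroups have bounded
  index in their pure hulls (`exists_bound_pureHull`).

Both facts about the quotient come from the substitutions that fix the variables in `Y` and replace
every other variable by a power of `x₀`. For generic exponents such a substitution maps any given
finite set of monomials injectively (Kronecker's trick), hence keeps given polynomials primitive and
acts on given elements like a retraction `ρ` onto `primFrac Y`. The product `P` of the operators
`1 - ρ` over all `Yᵢ` is the identity modulo `S` and kills given elements of the `primFrac Yᵢ`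
(`exists_projection`). If `m • z ∈ S`, then `P z = 0` and so `z ∈ S`. If `m • z` lies in `S` plus the
span of fractions `zⱼ`, then `m` divides, by Gauss's lemma, a linear combination of the numerators of
the `P zⱼ`. Their coefficients are bounded independently of the choice of exponents, since
substitutions do not increase the sum of the absolute values of the coefficients. Hence only
finitely many integer matrices are relevant, and one exponent serves for all (`exists_uniform_exponent`).
-/

namespace FreeNoetherian

section

/-! ### Filtrations and Pontryagin's criterion -/

open Submodule

variable {V : Type*} [AddCommGroup V]

/-- `FreeOver S N` says that `(S + N) / S` is a free abelian group. The encoding is by a set `B` of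
representatives in `N` of a basis of the quotient. -/
def FreeOver (S N : Submodule ℤ V) : Prop :=
  ∃ B : Set V, B ⊆ N ∧ N ≤ S ⊔ span ℤ B ∧ LinearIndepOn ℤ S.mkQ B

theorem FreeOver.free {N : Submodule ℤ V} (h : FreeOver ⊥ N) : Module.Free ℤ N := by
  obtain ⟨B, hBN, hspan, hli⟩ := h
  have hli' : LinearIndependent ℤ (fun b : B => (b : V)) := by
    have : LinearIndependent ℤ ((⊥ : Submodule ℤ V).mkQ ∘ fun b : B => (b : V)) := hli
    exact this.of_comp _
  have hN : N = span ℤ (Set.range fun b : B => (b : V)) := by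
    rw [Subtype.range_coe]
    exact le_antisymm (by simpa using hspan) (span_le.2 hBN)
  rw [hN]
  exact Module.Free.of_basis (Module.Basis.span hli')

theorem freeOver_of_free_map {S N : Submodule ℤ V} (h : Module.Free ℤ (N.map S.mkQ)) :
    FreeOver S N := by
  let b := Module.Free.chooseBasis ℤ (N.map S.mkQ)
  choose g hgN hg using fun i => Submodule.mem_map.1 (b i).2
  refine ⟨Set.range g, by rintro _ ⟨i, rfl⟩; exact hgN i, ?_, ?_⟩
  · intro z hz
    have h1 : S.mkQ z ∈ (span ℤ (Set.range g)).map S.mkQ := by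
      rw [map_span, ← Set.range_comp]
      have h2 : S.mkQ ∘ g = (N.map S.mkQ).subtype ∘ b := funext hg
      rw [h2, Set.range_comp, ← map_span, b.span_eq, map_subtype_top]
      exact mem_map_of_mem hz
    obtain ⟨w, hw, hwz⟩ := mem_map.1 h1
    have h3 : z - w ∈ S := by
      rw [← S.ker_mkQ, LinearMap.mem_ker, map_sub, hwz, sub_self]
    rw [← sub_add_cancel z w]
    exact add_mem (mem_sup_left h3) (mem_sup_right hw)
  · have h2 : S.mkQ ∘ g = (N.map S.mkQ).subtype ∘ b := funext hg
    have h3 : LinearIndependent ℤ (S.mkQ ∘ g) := by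
      rw [h2]
      exact b.linearIndependent.map' _ (ker_subtype _)
    have hginj : Function.Injective g := h3.injective.of_comp
    exact (linearIndepOn_range_iff hginj _).2 h3

/-- Transfinite filtrations with free quotients have free union. The hypotheses on `L` say that,
modulo `S`, it is the union of the earlier members of the filtration. -/
theorem freeOver_of_filtration {ι : Type*} [LinearOrder ι] [WellFoundedLT ι]
    (S N : Submodule ℤ V) (U L : ι → Submodule ℤ V) (hN : N = ⨆ i, U i)
    (hUL : ∀ i j, j < i → U j ≤ L i) (hL : ∀ i, L i ≤ S ⊔ ⨆ j : Set.Iio i, U j)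
    (h : ∀ i, FreeOver (S ⊔ L i) (U i)) : FreeOver S N := by
  classical
  choose B hBU hspan hli using h
  subst hN
  refine ⟨⋃ i, B i, ?_, ?_, ?_⟩
  · exact Set.iUnion_subset fun i => (hBU i).trans (le_iSup U i)
  · refine iSup_le fun i => ?_
    induction i using WellFoundedLT.induction with
    | ind i ih =>
      refine (hspan i).trans (sup_le (sup_le le_sup_left ((hL i).trans ?_)) ?_)
      · exact sup_le le_sup_left (iSup_le fun j => ih j j.2)
      · exact le_sup_of_le_right (span_mono (Set.subset_iUnion B i))
  · rw [linearIndepOn_iff]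
    intro c hc hc0
    by_contra hne
    have hmem : ∀ b ∈ c.support, ∃ i, b ∈ B i := fun b hb => by
      simpa using (Finsupp.mem_supported _ _).1 hc hb
    have : Nonempty ι := (hmem _ (Finsupp.support_nonempty_iff.2 hne).choose_spec).nonempty
    choose! f hf using hmem
    obtain ⟨b₀, hb₀, hmax⟩ := Finset.exists_max_image c.support f
      (Finsupp.support_nonempty_iff.2 hne)
    -- Split off the terms of the highest index; the rest lies in `L`.
    set c₁ := c.filter fun b => f b = f b₀
    set c₂ := c.filter fun b => ¬ f b = f b₀
    have hsum : c₁ + c₂ = c := Finsupp.filter_add_filter_not c _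
    have hc₂ : Finsupp.linearCombination ℤ id c₂ ∈ L (f b₀) := by
      rw [Finsupp.linearCombination_apply, Finsupp.sum]
      refine sum_mem fun b hb => smul_mem _ _ ?_
      rw [Finsupp.support_filter, Finset.mem_filter] at hb
      exact hUL _ _ (lt_of_le_of_ne (hmax b hb.1) hb.2) (hBU _ (hf b hb.1))
    have hcS : Finsupp.linearCombination ℤ id c ∈ S := by
      rw [← S.ker_mkQ, LinearMap.mem_ker, ← hc0, Finsupp.apply_linearCombination]
      rfl
    have hc₁ : Finsupp.linearCombination ℤ (S ⊔ L (f b₀)).mkQ c₁ = 0 := by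
      have h1 : Finsupp.linearCombination ℤ id c₁ ∈ S ⊔ L (f b₀) := by
        rw [← hsum, map_add] at hcS
        rw [← add_sub_cancel_right (Finsupp.linearCombination ℤ id c₁)
          (Finsupp.linearCombination ℤ id c₂)]
        exact sub_mem (mem_sup_left hcS) (mem_sup_right hc₂)
      rw [← (S ⊔ L (f b₀)).ker_mkQ, LinearMap.mem_ker, Finsupp.apply_linearCombination] at h1
      exact h1
    have h0 := linearIndepOn_iff.1 (hli (f b₀)) c₁ ?_ hc₁
    · have h1 : c₁ b₀ = c b₀ := Finsupp.filter_apply_pos (fun b => f b = f b₀) c rfl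
      rw [h0] at h1
      exact Finsupp.mem_support_iff.1 hb₀ h1.symm
    · rw [Finsupp.mem_supported, Finsupp.support_filter]
      intro b hb
      rw [Finset.mem_coe, Finset.mem_filter] at hb
      rw [← hb.2]
      exact hf b hb.1

/-- The elements of `N` with a nonzero multiple in `T`. -/
def pureHull (N T : Submodule ℤ V) : Submodule ℤ V where
  carrier := {z | z ∈ N ∧ ∃ m : ℤ, m ≠ 0 ∧ m • z ∈ T}
  zero_mem' := ⟨zero_mem _, 1, one_ne_zero, by simp⟩
  add_mem' := by
    rintro a b ⟨ha, m, hm, hma⟩ ⟨hb, n, hn, hnb⟩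
    refine ⟨add_mem ha hb, m * n, mul_ne_zero hm hn, ?_⟩
    rw [smul_add, mul_smul m n b, mul_comm m n, mul_smul]
    exact add_mem (smul_mem _ _ hma) (smul_mem _ _ hnb)
  smul_mem' := by
    rintro c a ⟨ha, m, hm, hma⟩
    refine ⟨smul_mem _ _ ha, m, hm, ?_⟩
    rw [smul_comm]
    exact smul_mem _ _ hma

/-- If `T / S` is finitely generated and a single `D` multiplies the pure hull of `T` into `T`, then
the pure hull is finitely generated modulo `S`. -/
theorem fg_map_pureHull {S N T : Submodule ℤ V} {D : ℤ} (hD : D ≠ 0)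
    (hpure : ∀ m : ℤ, m ≠ 0 → ∀ z ∈ N, m • z ∈ S → z ∈ S)
    (hT : (T.map S.mkQ).FG) (h : ∀ z ∈ pureHull N T, D • z ∈ T) :
    ((pureHull N T).map S.mkQ).FG := by
  have : IsNoetherian ℤ (T.map S.mkQ) := isNoetherian_of_fg_of_noetherian _ hT
  let A := (pureHull N T).map S.mkQ
  have hA : ∀ a ∈ A, D • a ∈ T.map S.mkQ := by
    intro a ha
    obtain ⟨z, hz, rfl⟩ := mem_map.1 ha
    rw [← map_smul]
    exact mem_map_of_mem (h z hz)
  let g : A →ₗ[ℤ] T.map S.mkQ := (D • LinearMap.id (R := ℤ) (M := V ⧸ S)).restrict hA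
  have hg : Function.Injective g := by
    rw [injective_iff_map_eq_zero]
    rintro ⟨a, ha⟩ h0
    obtain ⟨z, hz, rfl⟩ := mem_map.1 ha
    have h1 : D • S.mkQ z = 0 := congrArg Subtype.val h0
    rw [← map_smul, mkQ_apply, Quotient.mk_eq_zero] at h1
    exact Subtype.ext ((Quotient.mk_eq_zero _).2 (hpure D hD z hz.1 h1))
  have : IsNoetherian ℤ A := isNoetherian_of_injective g hg
  exact Module.Finite.iff_fg.1 (inferInstance : Module.Finite ℤ A)

/-- Pontryagin's criterion, relative to `S`: a countable torsion-free abelian group is free if every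
finitely generated subgroup has bounded index in its pure hull. -/
theorem freeOver_of_countable {S N : Submodule ℤ V} (hN : (N : Set V).Countable)
    (hpure : ∀ m : ℤ, m ≠ 0 → ∀ z ∈ N, m • z ∈ S → z ∈ S)
    (hfin : ∀ (k : ℕ) (f : Fin k → V), (∀ j, f j ∈ N) → ∃ D : ℤ, D ≠ 0 ∧
      ∀ z ∈ N, ∀ m : ℤ, m ≠ 0 → m • z ∈ S ⊔ span ℤ (Set.range f) →
        D • z ∈ S ⊔ span ℤ (Set.range f)) : FreeOver S N := by
  obtain ⟨g, hg⟩ := hN.exists_eq_range ⟨0, zero_mem N⟩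
  have hgN : ∀ n, g n ∈ N := fun n => by
    rw [← SetLike.mem_coe, hg]; exact ⟨n, rfl⟩
  let T : ℕ → Submodule ℤ V := fun n => S ⊔ span ℤ (Set.range fun j : Fin n => g j)
  have hTmono : Monotone T := fun a b hab => sup_le_sup_left (span_mono (by
    rintro _ ⟨j, rfl⟩
    exact ⟨Fin.castLE hab j, rfl⟩)) _
  let H : ℕ → Submodule ℤ V := fun n => pureHull N (T n)
  have hHmono : Monotone H := fun a b hab z ⟨hz, m, hm, hmz⟩ => ⟨hz, m, hm, hTmono hab hmz⟩
  have hgT : ∀ n, g n ∈ T (n + 1) := fun n =>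
    mem_sup_right (subset_span ⟨Fin.last n, rfl⟩)
  refine freeOver_of_filtration S N (fun n => H (n + 1)) H ?_ (fun i j hij => hHmono hij) ?_ ?_
  · refine le_antisymm (fun z hz => ?_) (iSup_le fun n z hz => hz.1)
    rw [← SetLike.mem_coe, hg] at hz
    obtain ⟨n, rfl⟩ := hz
    exact mem_iSup_of_mem n ⟨hgN n, 1, one_ne_zero, by simpa using hgT n⟩
  · rintro (_ | n)
    · rintro z ⟨hz, m, hm, hmz⟩
      exact mem_sup_left (hpure m hm z hz (by simpa [T] using hmz))
    · exact le_sup_of_le_right (le_iSup_of_le ⟨n, Nat.lt_succ_self n⟩ le_rfl)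
  · intro n
    apply freeOver_of_free_map
    have hfg : ((H (n + 1)).map S.mkQ).FG := by
      obtain ⟨D, hD, hDz⟩ := hfin (n + 1) (fun j => g j) (fun j => hgN j)
      refine fg_map_pureHull hD hpure ?_ fun z ⟨hz, m, hm, hmz⟩ => hDz z hz m hm hmz
      rw [Submodule.map_sup, mkQ_map_self, bot_sup_eq]
      exact (fg_span (Set.finite_range _)).map _
    have hfg' : ((H (n + 1)).map (S ⊔ H n).mkQ).FG := by
      have h1 : (S ⊔ H n).mkQ = (factor (le_sup_left : S ≤ S ⊔ H n)).comp S.mkQ := by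
        ext z; rfl
      rw [h1, map_comp]
      exact hfg.map _
    have : Module.Finite ℤ ((H (n + 1)).map (S ⊔ H n).mkQ) := Module.Finite.iff_fg.2 hfg'
    have : Module.IsTorsionFree ℤ ((H (n + 1)).map (S ⊔ H n).mkQ) := by
      rw [Module.isTorsionFree_iff_smul_eq_zero]
      rintro m ⟨a, ha⟩ h0
      rw [or_iff_not_imp_left]
      intro hm
      obtain ⟨z, hz, rfl⟩ := mem_map.1 ha
      have h1 : m • (S ⊔ H n).mkQ z = 0 := congrArg Subtype.val h0
      rw [← map_smul, mkQ_apply, Quotient.mk_eq_zero] at h1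
      refine Subtype.ext ((Quotient.mk_eq_zero _).2 ?_)
      obtain ⟨s, hs, w, ⟨hw, m', hm', hmw⟩, hsw⟩ := mem_sup.1 h1
      refine mem_sup_right ⟨hz.1, m' * m, mul_ne_zero hm' hm, ?_⟩
      rw [mul_smul, ← hsw, smul_add]
      exact add_mem (mem_sup_left (smul_mem _ _ hs)) hmw
    exact Module.free_of_finite_type_torsion_free'

/-- Integer linear maps whose matrices have entries in a fixed box have cokernels with torsion of
bounded exponent: up to duplicate rows there are only finitely many such matrices. -/
theorem exists_uniform_exponent (k : ℕ) (B : ℕ) : ∃ D : ℤ, D ≠ 0 ∧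
    ∀ {ι : Type*} (v : Fin k → ι → ℤ), (∀ j c, |v j c| ≤ B) →
      ∀ (a : Fin k → ℤ) (m : ℤ), m ≠ 0 → (∀ c, m ∣ ∑ j, a j * v j c) →
        ∃ b : Fin k → ℤ, ∀ c, D * ∑ j, a j * v j c = m * ∑ j, b j * v j c := by
  classical
  let box : Finset (Fin k → ℤ) := Fintype.piFinset fun _ => Finset.Icc (-(B : ℤ)) B
  have key : ∀ C : Finset (Fin k → ℤ), ∃ D : ℤ, D ≠ 0 ∧ ∀ (a : Fin k → ℤ) (m : ℤ), m ≠ 0 →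
      (∀ w ∈ C, m ∣ ∑ j, a j * w j) →
        ∃ b : Fin k → ℤ, ∀ w ∈ C, D * ∑ j, a j * w j = m * ∑ j, b j * w j := by
    intro C
    let f : (Fin k → ℤ) →ₗ[ℤ] (C → ℤ) :=
      LinearMap.pi fun w => ∑ j, (w : Fin k → ℤ) j • LinearMap.proj j
    have hf : ∀ a w, f a w = ∑ j, a j * (w : Fin k → ℤ) j := fun a w => by
      simp [f, LinearMap.pi_apply, LinearMap.sum_apply, mul_comm]
    obtain ⟨D, hD, hD0⟩ := Submodule.annihilator_top_inter_nonZeroDivisors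
      (R := ℤ) (M := torsion ℤ ((C → ℤ) ⧸ LinearMap.range f)) (torsion_isTorsion)
    refine ⟨D, nonZeroDivisors.ne_zero hD0, fun a m hm hdvd => ?_⟩
    choose u hu using hdvd
    let u' : C → ℤ := fun w => u w w.2
    have hu' : f a = m • u' := funext fun w => by
      rw [hf, hu w w.2, Pi.smul_apply, smul_eq_mul]
    have ht : (LinearMap.range f).mkQ u' ∈ torsion ℤ ((C → ℤ) ⧸ LinearMap.range f) := by
      rw [mem_torsion_iff]
      refine ⟨⟨m, mem_nonZeroDivisors_of_ne_zero hm⟩, ?_⟩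
      change m • (LinearMap.range f).mkQ u' = 0
      rw [← map_smul, ← hu', mkQ_apply, Quotient.mk_eq_zero]
      exact ⟨a, rfl⟩
    have hDu : D • (LinearMap.range f).mkQ u' = 0 :=
      congrArg Subtype.val (mem_annihilator.1 hD ⟨_, ht⟩ trivial)
    rw [← map_smul, mkQ_apply, Quotient.mk_eq_zero] at hDu
    obtain ⟨b, hb⟩ := hDu
    refine ⟨b, fun w hw => ?_⟩
    rw [← hf a ⟨w, hw⟩, ← hf b ⟨w, hw⟩, hb, hu', Pi.smul_apply, Pi.smul_apply, smul_eq_mul,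
      smul_eq_mul, mul_left_comm]
  choose D hD0 hD using key
  refine ⟨∏ C ∈ box.powerset, D C, Finset.prod_ne_zero_iff.2 fun C _ => hD0 C, ?_⟩
  intro ι v hv a m hm hdvd
  let C : Finset (Fin k → ℤ) := box.filter fun w => ∃ c, w = fun j => v j c
  obtain ⟨b, hb⟩ := hD C a m hm (by
    intro w hw
    obtain ⟨c, rfl⟩ := (Finset.mem_filter.1 hw).2
    exact hdvd c)
  obtain ⟨E, hE⟩ : D C ∣ ∏ C ∈ box.powerset, D C :=
    Finset.dvd_prod_of_mem _ (Finset.mem_powerset.2 (Finset.filter_subset _ _))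
  refine ⟨fun j => E * b j, fun c => ?_⟩
  have := hb (fun j => v j c) (Finset.mem_filter.2 ⟨by
    simpa [box, Fintype.mem_piFinset, ← abs_le] using fun j => hv j c, c, rfl⟩)
  simp only [mul_assoc, ← Finset.mul_sum]
  rw [hE, mul_comm (D C) E, mul_assoc, this, mul_left_comm]

end

section

open MvPolynomial

variable {σ : Type*}

/-! ### Primitive polynomials -/

/-- Every nonzero polynomial is an integer (its content) times a primitive polynomial. -/
theorem exists_eq_C_mul_isPrimitive {p : MvPolynomial σ ℤ} (hp : p ≠ 0) :
    ∃ (c : ℤ) (r : MvPolynomial σ ℤ), IsPrimitive r ∧ p = C c * r := by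
  set c : ℤ := p.support.gcd fun m => p.coeff m
  have hdvd : C c ∣ p := by
    rw [C_dvd_iff_dvd_coeff]
    intro m
    by_cases hm : m ∈ p.support
    · exact Finset.gcd_dvd hm
    · rw [notMem_support_iff.1 hm]; exact dvd_zero _
  obtain ⟨r, hr⟩ := hdvd
  refine ⟨c, r, fun n hn => ?_, hr⟩
  have hc : c ≠ 0 := by
    intro h
    rw [h, C_0, zero_mul] at hr
    exact hp hr
  have h1 : C (c * n) ∣ p := by
    rw [C_mul]
    conv_rhs => rw [hr]
    exact mul_dvd_mul_left _ hn
  have h2 : c * n ∣ c * 1 := by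
    rw [mul_one]
    exact Finset.dvd_gcd fun m _ => (C_dvd_iff_dvd_coeff _ _).1 h1 m
  exact isUnit_of_dvd_one ((mul_dvd_mul_iff_left hc).1 h2)

/-- A primitive factor can be cancelled from a divisibility by an integer. -/
theorem IsPrimitive.C_dvd_of_dvd_mul {w : MvPolynomial σ ℤ} (hw : IsPrimitive w) (n : ℤ) :
    ∀ v : MvPolynomial σ ℤ, C n ∣ w * v → C n ∣ v := by
  induction n using UniqueFactorizationMonoid.induction_on_prime with
  | h₁ =>
    intro v h
    rw [C_0, zero_dvd_iff] at h ⊢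
    exact (mul_eq_zero.1 h).resolve_left hw.ne_zero
  | h₂ u hu => exact fun v _ => (hu.map C).dvd
  | h₃ a p _ hp ih =>
    intro v h
    have hC : Prime (C p : MvPolynomial σ ℤ) := (prime_C_iff σ).2 hp
    rw [C_mul] at h ⊢
    obtain ⟨v', rfl⟩ := (hC.dvd_or_dvd ((dvd_mul_right _ _).trans h)).resolve_left
      fun h1 => hp.not_isUnit (hw p h1)
    rw [mul_left_comm, mul_dvd_mul_iff_left hC.ne_zero] at h
    exact mul_dvd_mul_left _ (ih v' h)

/-! ### The length of a polynomial -/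

/-- The sum of the absolute values of the coefficients. -/
noncomputable def length (p : MvPolynomial σ ℤ) : ℕ := ∑ m ∈ p.support, (p.coeff m).natAbs

theorem natAbs_coeff_le_length (p : MvPolynomial σ ℤ) (m : σ →₀ ℕ) :
    (p.coeff m).natAbs ≤ length p := by
  by_cases hm : m ∈ p.support
  · exact Finset.single_le_sum (f := fun m => (p.coeff m).natAbs) (fun _ _ => Nat.zero_le _) hm
  · rw [notMem_support_iff.1 hm]; exact Nat.zero_le _

theorem length_eq_sum {p : MvPolynomial σ ℤ} {T : Finset (σ →₀ ℕ)} (h : p.support ⊆ T) :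
    length p = ∑ m ∈ T, (p.coeff m).natAbs :=
  Finset.sum_subset h fun m _ hm => by rw [notMem_support_iff.1 hm]; rfl

theorem length_zero : length (0 : MvPolynomial σ ℤ) = 0 := by simp [length]

theorem length_add_le (p q : MvPolynomial σ ℤ) : length (p + q) ≤ length p + length q := by
  classical
  rw [length_eq_sum (support_add (p := p) (q := q)), length_eq_sum Finset.subset_union_left,
    length_eq_sum (p := q) Finset.subset_union_right, ← Finset.sum_add_distrib]
  exact Finset.sum_le_sum fun m _ => by rw [coeff_add]; exact Int.natAbs_add_le _ _

theorem length_neg (p : MvPolynomial σ ℤ) : length (-p) = length p := by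
  simp [length, support_neg]

theorem length_monomial_le (m : σ →₀ ℕ) (c : ℤ) : length (monomial m c) ≤ c.natAbs := by
  classical
  rw [length_eq_sum (support_monomial_subset)]
  simp

theorem length_sum_le {ι : Type*} (s : Finset ι) (f : ι → MvPolynomial σ ℤ) :
    length (∑ i ∈ s, f i) ≤ ∑ i ∈ s, length (f i) :=
  Finset.le_sum_of_subadditive _ length_zero.le length_add_le _ _

/-- An additive map is bounded for `length` as soon as it is bounded on monomials. -/
theorem length_map_le {τ : Type*} (f : MvPolynomial σ ℤ →+ MvPolynomial τ ℤ) (D : ℕ)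
    (hf : ∀ m c, length (f (monomial m c)) ≤ c.natAbs * D) (p : MvPolynomial σ ℤ) :
    length (f p) ≤ length p * D := by
  conv_lhs => rw [p.as_sum, map_sum]
  refine (length_sum_le _ _).trans ?_
  rw [length, Finset.sum_mul]
  exact Finset.sum_le_sum fun m _ => hf m _

theorem length_mul_le (p q : MvPolynomial σ ℤ) : length (p * q) ≤ length p * length q := by
  refine length_map_le (AddMonoidHom.mulRight q) _ (fun m c => ?_) p
  change length (monomial m c * q) ≤ _
  rw [mul_comm c.natAbs, mul_comm]
  refine length_map_le (AddMonoidHom.mulRight (monomial m c)) _ (fun m' c' => ?_) q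
  change length (monomial m' c' * monomial m c) ≤ _
  rw [monomial_mul, ← Int.natAbs_mul]
  exact length_monomial_le _ _

/-! ### Substituting powers of one variable -/

/-- The substitution which fixes the variables in `Y` and replaces each other variable `x` by
`x₀ ^ e x`. -/
noncomputable def subst (Y : Set σ) [DecidablePred (· ∈ Y)] (x₀ : σ) (e : σ → ℕ) :
    MvPolynomial σ ℤ →ₐ[ℤ] MvPolynomial σ ℤ :=
  aeval fun x => if x ∈ Y then X x else X x₀ ^ e x

variable (Y : Set σ) [DecidablePred (· ∈ Y)] (x₀ : σ) (e : σ → ℕ)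

/-- The effect of `subst` on exponents. -/
noncomputable def substExp (m : σ →₀ ℕ) : σ →₀ ℕ :=
  m.sum fun x k => if x ∈ Y then Finsupp.single x k else Finsupp.single x₀ (k * e x)

theorem subst_monomial (m : σ →₀ ℕ) (c : ℤ) :
    subst Y x₀ e (monomial m c) = monomial (substExp Y x₀ e m) c := by
  rw [subst, aeval_monomial, substExp, monomial_finsupp_sum_index, algebraMap_eq]
  congr 1
  refine Finset.prod_congr rfl fun x _ => ?_
  simp only
  split_ifs
  · rw [X_pow_eq_monomial]
  · rw [← pow_mul, X_pow_eq_monomial, mul_comm]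

theorem length_subst_le (p : MvPolynomial σ ℤ) : length (subst Y x₀ e p) ≤ length p := by
  rw [← mul_one (length p)]
  refine length_map_le (subst Y x₀ e : MvPolynomial σ ℤ →+ MvPolynomial σ ℤ) 1 (fun m c => ?_) p
  rw [mul_one]
  refine le_trans (le_of_eq ?_) (length_monomial_le (substExp Y x₀ e m) c)
  exact congrArg length (subst_monomial Y x₀ e m c)

theorem subst_eq_self {p : MvPolynomial σ ℤ} (hp : p ∈ supported ℤ Y) : subst Y x₀ e p = p := by
  have : Set.EqOn (subst Y x₀ e) (AlgHom.id ℤ _) (supported ℤ Y) := by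
    rw [supported_eq_adjoin_X]
    refine AlgHom.eqOn_adjoin_iff.2 ?_
    rintro _ ⟨x, hx, rfl⟩
    simp [subst, hx]
  exact this hp

theorem subst_mem_supported (hx₀ : x₀ ∈ Y) (p : MvPolynomial σ ℤ) :
    subst Y x₀ e p ∈ supported ℤ Y := by
  induction p using MvPolynomial.induction_on with
  | C a => rw [← algebraMap_eq, AlgHom.commutes]; exact Subalgebra.algebraMap_mem _ _
  | add p q hp hq => rw [map_add]; exact add_mem hp hq
  | mul_X p x hp =>
    rw [map_mul]
    refine mul_mem hp ?_
    rw [subst, aeval_X]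
    split_ifs with h
    · exact (X_mem_supported (R := ℤ)).2 h
    · exact pow_mem ((X_mem_supported (R := ℤ)).2 hx₀) _

/-- `subst` preserves the ring of polynomials in a set of variables containing `x₀`. -/
theorem subst_mem_supported_of_mem {Z : Set σ} (hx₀ : x₀ ∈ Z) {p : MvPolynomial σ ℤ}
    (hp : p ∈ supported ℤ Z) : subst Y x₀ e p ∈ supported ℤ Z := by
  have : supported ℤ Z ≤ (supported ℤ Z).comap (subst Y x₀ e) := by
    rw [supported_eq_adjoin_X]
    refine Algebra.adjoin_le ?_
    rintro _ ⟨x, hx, rfl⟩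
    rw [← supported_eq_adjoin_X]
    change subst Y x₀ e (X x) ∈ supported ℤ Z
    rw [subst, aeval_X]
    split_ifs with h
    · exact (X_mem_supported (R := ℤ)).2 hx
    · exact pow_mem ((X_mem_supported (R := ℤ)).2 hx₀) _
  exact this hp

theorem substExp_apply_of_mem {m : σ →₀ ℕ} {y : σ} (hy : y ∈ Y) (hne : y ≠ x₀) :
    substExp Y x₀ e m y = m y := by
  classical
  rw [substExp, Finsupp.sum_apply, Finsupp.sum, Finset.sum_eq_single y]
  · rw [if_pos hy, Finsupp.single_eq_same]
  · intro x _ hx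
    split_ifs
    · exact Finsupp.single_eq_of_ne hx.symm
    · exact Finsupp.single_eq_of_ne hne
  · intro h
    rw [if_pos hy, Finsupp.single_eq_same]
    exact Finsupp.notMem_support_iff.1 h

/-- The exponent of `x₀` in `substExp Y x₀ e m`, as a linear polynomial in `e`. -/
noncomputable def genericExp (m : σ →₀ ℕ) : MvPolynomial σ ℤ :=
  open Classical in
  ∑ x ∈ m.support, C (m x : ℤ) * if x ∈ Y then (if x = x₀ then 1 else 0) else X x

theorem eval_genericExp (m : σ →₀ ℕ) :
    eval (fun x => (e x : ℤ)) (genericExp Y x₀ m) = substExp Y x₀ e m x₀ := by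
  classical
  rw [genericExp, map_sum, substExp, Finsupp.sum_apply, Finsupp.sum, Nat.cast_sum]
  refine Finset.sum_congr rfl fun x _ => ?_
  rw [map_mul, eval_C]
  split_ifs with h1 h2
  · simp [h2]
  · simp [h2]
  · simp

theorem coeff_genericExp {m : σ →₀ ℕ} {y : σ} (hy : y ∉ Y) :
    (genericExp Y x₀ m).coeff (Finsupp.single y 1) = m y := by
  classical
  rw [genericExp, coeff_sum, Finset.sum_eq_single y]
  · rw [if_neg hy, coeff_C_mul, coeff_X, if_pos rfl, mul_one]
  · intro x _ hx
    rw [coeff_C_mul]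
    split_ifs with h1 h2
    · rw [coeff_one, if_neg (by simp [eq_comm]), mul_zero]
    · rw [coeff_zero, mul_zero]
    · rw [coeff_X, if_neg (by simp [Finsupp.single_left_inj, hx]), mul_zero]
  · intro h
    rw [Finsupp.notMem_support_iff.1 h]
    simp

theorem constantCoeff_genericExp (hx₀ : x₀ ∈ Y) (m : σ →₀ ℕ) :
    constantCoeff (genericExp Y x₀ m) = m x₀ := by
  classical
  rw [genericExp, map_sum, Finset.sum_eq_single x₀]
  · simp [hx₀]
  · intro x _ hx
    rw [map_mul]
    split_ifs <;> simp
  · intro h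
    rw [Finsupp.notMem_support_iff.1 h]
    simp

/-- A generic choice of `e` avoids finitely many coincidences of exponents. -/
theorem exists_substExp_injOn (hx₀ : x₀ ∈ Y) (T : Finset (σ →₀ ℕ)) :
    ∃ e : σ → ℕ, Set.InjOn (substExp Y x₀ e) T := by
  classical
  let F : MvPolynomial σ ℤ := ∏ m ∈ T, ∏ m' ∈ T with genericExp Y x₀ m ≠ genericExp Y x₀ m',
    (genericExp Y x₀ m - genericExp Y x₀ m')
  have hF : F ≠ 0 := Finset.prod_ne_zero_iff.2 fun m _ => Finset.prod_ne_zero_iff.2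
    fun m' hm' => sub_ne_zero.2 (Finset.mem_filter.1 hm').2
  -- A nonzero polynomial does not vanish identically on tuples of natural numbers.
  obtain ⟨e, he⟩ : ∃ e : σ → ℕ, eval (fun x => (e x : ℤ)) F ≠ 0 := by
    by_contra! h
    refine hF (funext_set (fun _ => Set.range ((↑) : ℕ → ℤ))
      (fun _ => Set.infinite_range_of_injective Nat.cast_injective) fun x hx => ?_)
    choose e he using fun i => hx i trivial
    rw [map_zero, ← h e]
    simp only [he]
  refine ⟨e, fun m hm m' hm' hmm => ?_⟩
  have hG : genericExp Y x₀ m = genericExp Y x₀ m' := by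
    by_contra hne
    refine he ?_
    rw [map_prod]
    refine Finset.prod_eq_zero hm ?_
    rw [map_prod]
    refine Finset.prod_eq_zero (Finset.mem_filter.2 ⟨hm', hne⟩) ?_
    rw [map_sub, eval_genericExp, eval_genericExp, hmm, sub_self]
  ext y
  by_cases hy : y ∈ Y
  · by_cases hne : y = x₀
    · subst hne
      exact_mod_cast (constantCoeff_genericExp Y y hy m).symm.trans
        ((congrArg _ hG).trans (constantCoeff_genericExp Y y hy m'))
    · rw [← substExp_apply_of_mem Y x₀ e hy hne, hmm, substExp_apply_of_mem Y x₀ e hy hne]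
  · exact_mod_cast (coeff_genericExp Y x₀ (m := m) hy).symm.trans
      ((congrArg (coeff _) hG).trans (coeff_genericExp Y x₀ hy))

theorem coeff_subst {e : σ → ℕ} {T : Finset (σ →₀ ℕ)} (he : Set.InjOn (substExp Y x₀ e) T)
    {p : MvPolynomial σ ℤ} (hp : p.support ⊆ T) {m : σ →₀ ℕ} (hm : m ∈ T) :
    (subst Y x₀ e p).coeff (substExp Y x₀ e m) = p.coeff m := by
  classical
  conv_lhs => rw [p.as_sum, map_sum, coeff_sum]
  simp only [subst_monomial, coeff_monomial]
  rw [Finset.sum_eq_single m]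
  · simp
  · intro m' hm' hne
    exact if_neg fun h => hne (he (hp hm') hm h)
  · intro h
    simpa using h

/-- For generic exponents the substitution keeps given primitive polynomials primitive. -/
theorem exists_isPrimitive_subst (hx₀ : x₀ ∈ Y) (Q : Finset (MvPolynomial σ ℤ))
    (hQ : ∀ q ∈ Q, IsPrimitive q) : ∃ e : σ → ℕ, ∀ q ∈ Q, IsPrimitive (subst Y x₀ e q) := by
  classical
  obtain ⟨e, he⟩ := exists_substExp_injOn Y x₀ hx₀ (Q.biUnion support)
  refine ⟨e, fun q hq n hn => hQ q hq n ?_⟩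
  rw [C_dvd_iff_dvd_coeff] at hn ⊢
  intro m
  have hsub : q.support ⊆ Q.biUnion support := Finset.subset_biUnion_of_mem support hq
  by_cases hm : m ∈ q.support
  · rw [← coeff_subst Y x₀ he hsub (hsub hm)]
    exact hn _
  · rw [notMem_support_iff.1 hm]; exact dvd_zero _

end

section

open MvPolynomial Submodule

variable {σ : Type*} (K : Type*) [Field K] [Algebra (MvPolynomial σ ℤ) K]

/-! ### Fractions with primitive denominators -/

/-- The fraction `p / q` in `K`, which will be any field of fractions of `ℤ[σ]`. -/
noncomputable def frac (p q : MvPolynomial σ ℤ) : K :=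
  algebraMap _ K p / algebraMap _ K q

variable {K} in
theorem zsmul_frac (m : ℤ) (p q : MvPolynomial σ ℤ) : m • frac K p q = frac K (C m * p) q := by
  rw [frac, frac, map_mul, mul_div_assoc, zsmul_eq_mul, eq_intCast C, map_intCast]

variable {K} in
theorem sum_frac {ι : Type*} (s : Finset ι) (p : ι → MvPolynomial σ ℤ) (q : MvPolynomial σ ℤ) :
    ∑ i ∈ s, frac K (p i) q = frac K (∑ i ∈ s, p i) q := by
  simp only [frac, map_sum, Finset.sum_div]

variable (σ) in
theorem charZero_of_isFractionRing [IsFractionRing (MvPolynomial σ ℤ) K] : CharZero K :=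
  charZero_of_injective_algebraMap (IsFractionRing.injective (MvPolynomial σ ℤ) K)

variable [IsFractionRing (MvPolynomial σ ℤ) K]

variable {K}

theorem algebraMap_ne_zero_of_ne_zero {q : MvPolynomial σ ℤ} (hq : q ≠ 0) :
    algebraMap (MvPolynomial σ ℤ) K q ≠ 0 :=
  (map_ne_zero_iff _ (IsFractionRing.injective _ _)).2 hq

theorem frac_eq_frac_iff {p q p' q' : MvPolynomial σ ℤ} (hq : q ≠ 0) (hq' : q' ≠ 0) :
    frac K p q = frac K p' q' ↔ p * q' = p' * q := by
  rw [frac, frac, div_eq_div_iff (algebraMap_ne_zero_of_ne_zero hq)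
    (algebraMap_ne_zero_of_ne_zero hq'), ← map_mul, ← map_mul,
    (IsFractionRing.injective (MvPolynomial σ ℤ) K).eq_iff]

theorem frac_add {p q p' q' : MvPolynomial σ ℤ} (hq : q ≠ 0) (hq' : q' ≠ 0) :
    frac K p q + frac K p' q' = frac K (p * q' + q * p') (q * q') := by
  rw [frac, frac, div_add_div _ _ (algebraMap_ne_zero_of_ne_zero hq)
    (algebraMap_ne_zero_of_ne_zero hq'), frac, map_add, map_mul, map_mul, map_mul]

theorem frac_sub {p q p' q' : MvPolynomial σ ℤ} (hq : q ≠ 0) (hq' : q' ≠ 0) :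
    frac K p q - frac K p' q' = frac K (p * q' - q * p') (q * q') := by
  rw [frac, frac, div_sub_div _ _ (algebraMap_ne_zero_of_ne_zero hq)
    (algebraMap_ne_zero_of_ne_zero hq'), frac, map_sub, map_mul, map_mul, map_mul]

variable (K) in
/-- The additive group of the fractions `p / q`, where `q` is primitive and `p`, `q` are polynomials
in the variables in `W`. -/
def primFrac (W : Set σ) : Submodule ℤ K where
  carrier := {z | ∃ p ∈ supported ℤ W, ∃ q ∈ supported ℤ W, IsPrimitive q ∧ z = frac K p q}
  zero_mem' := ⟨0, zero_mem _, 1, one_mem _, isPrimitive_one, by simp [frac]⟩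
  add_mem' := by
    rintro _ _ ⟨p, hp, q, hq, hqp, rfl⟩ ⟨p', hp', q', hq', hqp', rfl⟩
    exact ⟨_, add_mem (mul_mem hp hq') (mul_mem hq hp'), _, mul_mem hq hq', hqp.mul hqp',
      frac_add hqp.ne_zero hqp'.ne_zero⟩
  smul_mem' := by
    rintro m _ ⟨p, hp, q, hq, hqp, rfl⟩
    exact ⟨C m * p, mul_mem (Subalgebra.algebraMap_mem _ m) hp, q, hq, hqp, zsmul_frac m p q⟩

theorem primFrac_mono {W W' : Set σ} (h : W ⊆ W') : primFrac K W ≤ primFrac K W' := by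
  rintro _ ⟨p, hp, q, hq, hqp, rfl⟩
  exact ⟨p, supported_mono h hp, q, supported_mono h hq, hqp, rfl⟩

theorem frac_mem_primFrac_univ (p : MvPolynomial σ ℤ) {q : MvPolynomial σ ℤ} (hq : IsPrimitive q) :
    frac K p q ∈ primFrac K (Set.univ : Set σ) :=
  ⟨p, by simp, q, by simp, hq, rfl⟩

/-- Finitely many fractions have a common denominator. -/
theorem exists_common_denominator {k : ℕ} {f : Fin k → K}
    (hf : ∀ j, f j ∈ primFrac K (Set.univ : Set σ)) :
    ∃ (p : Fin k → MvPolynomial σ ℤ) (q : MvPolynomial σ ℤ), IsPrimitive q ∧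
      ∀ j, f j = frac K (p j) q := by
  classical
  choose p _ q _ hq hpq using hf
  have hprod : IsPrimitive (∏ j, q j) :=
    Finset.prod_induction _ IsPrimitive (fun _ _ => IsPrimitive.mul) isPrimitive_one fun j _ => hq j
  refine ⟨fun j => p j * ∏ i ∈ Finset.univ.erase j, q i, _, hprod, fun j => ?_⟩
  rw [hpq j, frac_eq_frac_iff (hq j).ne_zero hprod.ne_zero, mul_assoc, mul_comm _ (q j),
    Finset.mul_prod_erase _ _ (Finset.mem_univ j)]

/-- A ring endomorphism of `ℤ[σ]` induces a map on the fractions whose denominators it does not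
kill. These form a `ℚ`-subspace of `K`, so that this map extends to an additive map on all of `K`. -/
theorem exists_linearMap_frac (φ : MvPolynomial σ ℤ →+* MvPolynomial σ ℤ)
    (hφ : ∀ m : ℤ, φ (C m) = C m) :
    ∃ ρ : K →ₗ[ℤ] K,
      ∀ p q, φ q ≠ 0 → ρ (frac K p q) = frac K (φ p) (φ q) := by
  have : CharZero K := charZero_of_isFractionRing σ K
  have hne : ∀ q, φ q ≠ 0 → q ≠ 0 := fun q h h0 => h (by rw [h0, map_zero])
  let A : Submodule ℚ K :=
    { carrier := {z | ∃ p q, φ q ≠ 0 ∧ z = frac K p q}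
      zero_mem' := ⟨0, 1, by simp, by simp [frac]⟩
      add_mem' := by
        rintro _ _ ⟨p, q, hq, rfl⟩ ⟨p', q', hq', rfl⟩
        exact ⟨_, q * q', by rw [map_mul]; exact mul_ne_zero hq hq',
          frac_add (hne q hq) (hne q' hq')⟩
      smul_mem' := by
        rintro a _ ⟨p, q, hq, rfl⟩
        refine ⟨C a.num * p, C (a.den : ℤ) * q, ?_, ?_⟩
        · rw [map_mul, hφ]
          exact mul_ne_zero (by simp) hq
        · rw [frac, frac, Algebra.smul_def, map_mul, map_mul, mul_div_mul_comm]
          congr 1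
          conv_lhs => rw [← Rat.num_div_den a]
          simp }
  have hA : ∀ z : A, ∃ w, ∀ p q, φ q ≠ 0 → (z : K) = frac K p q →
      w = frac K (φ p) (φ q) := by
    rintro ⟨_, p, q, hq, rfl⟩
    refine ⟨frac K (φ p) (φ q), fun p' q' hq' h => ?_⟩
    rw [frac_eq_frac_iff (hne q hq) (hne q' hq')] at h
    rw [frac_eq_frac_iff hq hq', ← map_mul, h, map_mul]
  choose g hg using hA
  let gA : A →+ K := AddMonoidHom.mk' g fun a b => by
    obtain ⟨p, q, hq, h⟩ := a.2
    obtain ⟨p', q', hq', h'⟩ := b.2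
    rw [hg a p q hq h, hg b p' q' hq' h', frac_add hq hq',
      hg (a + b) (p * q' + q * p') (q * q') (by rw [map_mul]; exact mul_ne_zero hq hq')]
    · simp only [map_add, map_mul]
    · rw [← frac_add (hne q hq) (hne q' hq'), ← h, ← h']; rfl
  obtain ⟨ρ, hρ⟩ := LinearMap.exists_extend gA.toRatLinearMap
  refine ⟨ρ.toAddMonoidHom.toIntLinearMap, fun p q hq => ?_⟩
  exact (LinearMap.congr_fun hρ ⟨frac K p q, p, q, hq, rfl⟩).trans (hg _ p q hq rfl)

/-- For given finite sets of data there is a substitution `φ`, with induced map `ρ` on fractions,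
which behaves on these data like a retraction of `primFrac univ` onto `primFrac Y`. There is
no such retraction defined everywhere, since a substitution destroys the primitivity of some
denominators. -/
theorem exists_retraction {Y : Set σ} {x₀ : σ} (hY : x₀ ∈ Y) (Z : Finset (Set σ))
    (hZ : ∀ W ∈ Z, x₀ ∈ W) (q : MvPolynomial σ ℤ) (hq : IsPrimitive q)
    (E : Finset K) :
    ∃ (φ : MvPolynomial σ ℤ →+* MvPolynomial σ ℤ)
      (ρ : K →ₗ[ℤ] K),
      (∀ p q, φ q ≠ 0 → ρ (frac K p q) = frac K (φ p) (φ q)) ∧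
      (∀ p, length (φ p) ≤ length p) ∧ IsPrimitive (φ q) ∧
      (∀ z ∈ primFrac K Y, ρ z = z) ∧
      (∀ W ∈ Z, ∀ z ∈ E, z ∈ primFrac K W → ρ z ∈ primFrac K W) ∧
      (∀ z ∈ E, z ∈ primFrac K (Set.univ : Set σ) → ρ z ∈ primFrac K Y) := by
  classical
  have hden : ∀ (W : Set σ) (z : K), ∃ d : MvPolynomial σ ℤ,
      IsPrimitive d ∧ (z ∈ primFrac K W → ∃ p ∈ supported ℤ W, d ∈ supported ℤ W ∧ z = frac K p d) := by
    intro W z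
    by_cases hz : z ∈ primFrac K W
    · obtain ⟨p, hp, d, hd, hdp, h⟩ := hz
      exact ⟨d, hdp, fun _ => ⟨p, hp, hd, h⟩⟩
    · exact ⟨1, isPrimitive_one, fun h => absurd h hz⟩
  choose den hprim hden using hden
  obtain ⟨e, he⟩ := exists_isPrimitive_subst Y x₀ hY
    (insert q ((insert Set.univ Z ×ˢ E).image fun a => den a.1 a.2)) (by
      intro d hd
      rcases Finset.mem_insert.1 hd with rfl | hd
      · exact hq
      · obtain ⟨a, _, rfl⟩ := Finset.mem_image.1 hd
        exact hprim _ _)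
  have he' : ∀ W ∈ insert Set.univ Z, ∀ z ∈ E, IsPrimitive (subst Y x₀ e (den W z)) :=
    fun W hW z hz => he _ (Finset.mem_insert_of_mem
      (Finset.mem_image.2 ⟨(W, z), Finset.mk_mem_product hW hz, rfl⟩))
  obtain ⟨ρ, hρ⟩ := exists_linearMap_frac (K := K) (subst Y x₀ e : MvPolynomial σ ℤ →+* MvPolynomial σ ℤ)
    fun m => (subst Y x₀ e).commutes m
  refine ⟨_, ρ, hρ, length_subst_le Y x₀ e, he q (Finset.mem_insert_self _ _), ?_, ?_, ?_⟩
  · rintro _ ⟨p, hp, d, hd, hdp, rfl⟩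
    have h1 : (subst Y x₀ e : MvPolynomial σ ℤ →+* MvPolynomial σ ℤ) d = d :=
      subst_eq_self Y x₀ e hd
    rw [hρ p d (by rw [h1]; exact hdp.ne_zero), h1]
    exact congrArg (frac K · d) (subst_eq_self Y x₀ e hp)
  · intro W hW z hz hzW
    have h1 := he' W (Finset.mem_insert_of_mem hW) z hz
    obtain ⟨p, hp, hd, h⟩ := hden W z hzW
    refine ⟨subst Y x₀ e p, subst_mem_supported_of_mem Y x₀ e (hZ W hW) hp, _,
      subst_mem_supported_of_mem Y x₀ e (hZ W hW) hd, h1, ?_⟩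
    conv_lhs => rw [h]
    exact hρ p (den W z) h1.ne_zero
  · intro z hz hzu
    have h1 := he' Set.univ (Finset.mem_insert_self _ _) z hz
    obtain ⟨p, hp, hd, h⟩ := hden Set.univ z hzu
    refine ⟨subst Y x₀ e p, subst_mem_supported Y x₀ e hY p, _,
      subst_mem_supported Y x₀ e hY _, h1, ?_⟩
    conv_lhs => rw [h]
    exact hρ p (den Set.univ z) h1.ne_zero

/-! ### Finite sums of groups of fractions -/

variable (K) in
/-- The sum of the groups `primFrac Y` for `Y` in a list. -/
noncomputable def sumPrimFrac : List (Set σ) → Submodule ℤ K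
  | [] => ⊥
  | Y :: L => primFrac K Y ⊔ sumPrimFrac L

theorem sumPrimFrac_cons (Y : Set σ) (L : List (Set σ)) :
    sumPrimFrac K (Y :: L) = primFrac K Y ⊔ sumPrimFrac K L := rfl

/-- An element of `sumPrimFrac L` is killed by every additive map that kills suitable finitely many
elements of the summands. -/
theorem exists_finset_of_mem_sumPrimFrac {L : List (Set σ)}
    {s : K} (hs : s ∈ sumPrimFrac K L) :
    ∃ F : Finset K,
      ∀ P : K →ₗ[ℤ] K,
        (∀ Y ∈ L, ∀ z ∈ F, z ∈ primFrac K Y → P z = 0) → P s = 0 := by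
  classical
  induction L generalizing s with
  | nil => exact ⟨∅, fun P _ => by rw [(mem_bot ℤ).1 hs, map_zero]⟩
  | cons Y L ih =>
    obtain ⟨a, ha, b, hb, rfl⟩ := mem_sup.1 hs
    obtain ⟨F, hF⟩ := ih hb
    refine ⟨insert a F, fun P hP => ?_⟩
    rw [map_add, hP Y List.mem_cons_self a (Finset.mem_insert_self _ _) ha, zero_add]
    exact hF P fun Y' hY' z hz => hP Y' (List.mem_cons_of_mem _ hY') z (Finset.mem_insert_of_mem hz)

/-- For given finite data there is an additive map `P`, the product of `1 - ρ` over retractions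
`ρ` to the members of `L`, which kills the summands of `sumPrimFrac L` and is the identity modulo
`sumPrimFrac L`. The lengths of the numerators of its values at the fractions `p j / q` are bounded
uniformly in all data other than the lengths of `p j` and `q`. -/
theorem exists_projection {x₀ : σ} (L : List (Set σ)) (hL : ∀ Y ∈ L, x₀ ∈ Y) (c : ℕ) :
    ∃ B : ℕ, ∀ (k : ℕ) (p : Fin k → MvPolynomial σ ℤ) (q : MvPolynomial σ ℤ),
      (∀ j, length (p j) ≤ c) → length q ≤ c → IsPrimitive q →
      ∀ E : Finset K,
      ∃ P : K →ₗ[ℤ] K,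
        (∀ Y ∈ L, ∀ z ∈ E, z ∈ primFrac K Y → P z = 0) ∧
        (∀ z ∈ E, z ∈ primFrac K (Set.univ : Set σ) →
          P z ∈ primFrac K (Set.univ : Set σ) ∧ z - P z ∈ sumPrimFrac K L) ∧
        ∃ (v : Fin k → MvPolynomial σ ℤ) (d : MvPolynomial σ ℤ), IsPrimitive d ∧
          ∀ j, length (v j) ≤ B ∧ P (frac K (p j) q) = frac K (v j) d := by
  classical
  induction L generalizing c with
  | nil =>
    exact ⟨c, fun k p q hp hq hqp E => ⟨LinearMap.id, by simp,
      fun z _ hz => ⟨hz, by rw [LinearMap.id_apply, sub_self]; exact zero_mem _⟩,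
      p, q, hqp, fun j => ⟨hp j, rfl⟩⟩⟩
  | cons Y L ih =>
    obtain ⟨B, hB⟩ := ih (fun Y' hY' => hL Y' (List.mem_cons_of_mem _ hY')) (c * c + c * c)
    refine ⟨B, fun k p q hp hq hqp E => ?_⟩
    obtain ⟨φ, ρ, hρ, hφ, hφq, hρY, hρL, hρu⟩ := exists_retraction (hL Y List.mem_cons_self)
      L.toFinset (fun W hW => hL W (List.mem_cons_of_mem _ (List.mem_toFinset.1 hW))) q hqp E
    obtain ⟨P, hP0, hP1, v, d, hd, hv⟩ := hB k (fun j => p j * φ q - q * φ (p j)) (q * φ q)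
      (fun j => by
        rw [sub_eq_add_neg]
        refine (length_add_le _ _).trans (add_le_add ?_ ?_)
        · exact (length_mul_le _ _).trans (Nat.mul_le_mul (hp j) ((hφ q).trans hq))
        · rw [length_neg]
          exact (length_mul_le _ _).trans (Nat.mul_le_mul hq ((hφ (p j)).trans (hp j))))
      ((length_mul_le _ _).trans
        ((Nat.mul_le_mul hq ((hφ q).trans hq)).trans (Nat.le_add_right _ _)))
      (hqp.mul hφq) (E.image fun z => z - ρ z)
    have hPapply : ∀ z, (P ∘ₗ (LinearMap.id - ρ)) z = P (z - ρ z) := fun z => rfl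
    have hEmem : ∀ z ∈ E, z - ρ z ∈ E.image fun z => z - ρ z := fun z hz =>
      Finset.mem_image_of_mem (fun z => z - ρ z) hz
    refine ⟨P ∘ₗ (LinearMap.id - ρ), ?_, ?_, v, d, hd, fun j => ⟨(hv j).1, ?_⟩⟩
    · intro Y' hY' z hz hzY'
      rw [hPapply]
      rcases List.mem_cons.1 hY' with rfl | hY'
      · rw [hρY z hzY', sub_self, map_zero]
      · exact hP0 Y' hY' _ (hEmem z hz)
          (sub_mem hzY' (hρL Y' (List.mem_toFinset.2 hY') z hz hzY'))
    · intro z hz hzu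
      have h1 := hρu z hz hzu
      obtain ⟨h2, h3⟩ := hP1 _ (hEmem z hz) (sub_mem hzu (primFrac_mono (Set.subset_univ _) h1))
      rw [hPapply]
      refine ⟨h2, ?_⟩
      have h4 : z - P (z - ρ z) = ρ z + (z - ρ z - P (z - ρ z)) := by abel
      rw [h4]
      exact add_mem (mem_sup_left h1) (mem_sup_right h3)
    · rw [hPapply, hρ _ _ hφq.ne_zero, frac_sub hqp.ne_zero hφq.ne_zero]
      exact (hv j).2

/-- `sumPrimFrac L` is a pure subgroup of `primFrac univ`. -/
theorem mem_sumPrimFrac_of_smul_mem {x₀ : σ} {L : List (Set σ)} (hL : ∀ Y ∈ L, x₀ ∈ Y)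
    {m : ℤ} (hm : m ≠ 0) {z : K}
    (hz : z ∈ primFrac K (Set.univ : Set σ)) (hmz : m • z ∈ sumPrimFrac K L) : z ∈ sumPrimFrac K L := by
  classical
  have : CharZero K := charZero_of_isFractionRing σ K
  obtain ⟨F, hF⟩ := exists_finset_of_mem_sumPrimFrac hmz
  obtain ⟨B, hB⟩ := exists_projection (K := K) L hL (length (1 : MvPolynomial σ ℤ))
  obtain ⟨P, hP0, hP1, -⟩ := hB 0 Fin.elim0 1 (fun j => j.elim0) le_rfl isPrimitive_one (insert z F)
  have h1 : P (m • z) = 0 :=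
    hF P fun Y hY w hw => hP0 Y hY w (Finset.mem_insert_of_mem hw)
  rw [map_smul, smul_eq_zero, or_iff_right hm] at h1
  have h2 := (hP1 z (Finset.mem_insert_self _ _) hz).2
  rwa [h1, sub_zero] at h2

/-- Finitely generated subgroups of `primFrac K univ / sumPrimFrac K L` have bounded index in their
pure hulls. -/
theorem exists_bound_pureHull {x₀ : σ} {L : List (Set σ)} (hL : ∀ Y ∈ L, x₀ ∈ Y) {k : ℕ}
    {f : Fin k → K}
    (hf : ∀ j, f j ∈ primFrac K (Set.univ : Set σ)) :
    ∃ D : ℤ, D ≠ 0 ∧ ∀ z ∈ primFrac K (Set.univ : Set σ), ∀ m : ℤ, m ≠ 0 →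
      m • z ∈ sumPrimFrac K L ⊔ span ℤ (Set.range f) →
        D • z ∈ sumPrimFrac K L ⊔ span ℤ (Set.range f) := by
  classical
  obtain ⟨p, q, hq, hpq⟩ := exists_common_denominator hf
  obtain ⟨B, hB⟩ := exists_projection (K := K) L hL (max (Finset.univ.sup fun j => length (p j)) (length q))
  obtain ⟨D, hD, hDv⟩ := exists_uniform_exponent k B
  refine ⟨D, hD, fun z hz m hm hmz => ?_⟩
  obtain ⟨s, hs, t, ht, hst⟩ := mem_sup.1 hmz
  obtain ⟨a, rfl⟩ := (mem_span_range_iff_exists_fun ℤ).1 ht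
  obtain ⟨F, hF⟩ := exists_finset_of_mem_sumPrimFrac hs
  obtain ⟨P, hP0, hP1, v, d, hd, hv⟩ := hB k p q
    (fun j => le_max_of_le_left (Finset.le_sup (f := fun j => length (p j)) (Finset.mem_univ j)))
    (le_max_right _ _) hq (insert z (Finset.univ.image f ∪ F))
  have hPs : P s = 0 := hF P fun Y hY w hw => hP0 Y hY w
    (Finset.mem_insert_of_mem (Finset.mem_union_right _ hw))
  have hPf : ∀ j, P (f j) = frac K (v j) d := fun j => by rw [hpq j]; exact (hv j).2
  have hfS : ∀ j, f j - P (f j) ∈ sumPrimFrac K L := fun j => (hP1 _ (Finset.mem_insert_of_mem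
    (Finset.mem_union_left _ (Finset.mem_image_of_mem f (Finset.mem_univ j)))) (hf j)).2
  have hPcomb : ∀ b : Fin k → ℤ, P (∑ j, b j • f j) = frac K (∑ j, C (b j) * v j) d := fun b => by
    simp only [map_sum, map_smul, hPf, zsmul_frac, sum_frac]
  -- The numerator of `P (m • z)` is divisible by `m`, by Gauss's lemma.
  have hdvd : C m ∣ ∑ j, C (a j) * v j := by
    obtain ⟨u, -, w, -, hw, hPz⟩ := (hP1 z (Finset.mem_insert_self _ _) hz).1
    have h1 : P (m • z) = frac K (∑ j, C (a j) * v j) d := by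
      rw [← hst, map_add, hPs, zero_add, hPcomb]
    rw [map_smul, hPz, zsmul_frac, frac_eq_frac_iff hw.ne_zero hd.ne_zero] at h1
    refine hw.C_dvd_of_dvd_mul m _ ⟨u * d, ?_⟩
    rw [mul_comm w, ← h1, mul_assoc]
  have hcoeff : ∀ (b : Fin k → ℤ) (c : σ →₀ ℕ),
      (∑ j, C (b j) * v j).coeff c = ∑ j, b j * (v j).coeff c := fun b c => by
    simp only [coeff_sum, coeff_C_mul]
  obtain ⟨b, hb⟩ := hDv (fun j c => (v j).coeff c) (fun j c => by
    rw [Int.abs_eq_natAbs]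
    exact_mod_cast (natAbs_coeff_le_length (v j) c).trans (hv j).1) a m hm
    (fun c => by
      have := (C_dvd_iff_dvd_coeff _ _).1 hdvd c
      rwa [hcoeff] at this)
  -- `D • ∑ a j • f j - m • ∑ b j • f j` is killed by `P`, hence lies in `sumPrimFrac L`.
  have hy : D • ∑ j, a j • f j - m • ∑ j, b j • f j ∈ sumPrimFrac K L := by
    have hzero : P (D • ∑ j, a j • f j - m • ∑ j, b j • f j) = 0 := by
      rw [map_sub, map_smul, map_smul, hPcomb, hPcomb, zsmul_frac, zsmul_frac, sub_eq_zero]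
      congr 1
      ext c
      rw [coeff_C_mul, coeff_C_mul, hcoeff, hcoeff, hb]
    have hcomb : ∀ b : Fin k → ℤ, ∑ j, b j • f j - P (∑ j, b j • f j) ∈ sumPrimFrac K L := fun b => by
      rw [map_sum, ← Finset.sum_sub_distrib]
      refine sum_mem fun j _ => ?_
      rw [map_smul, ← smul_sub]
      exact smul_mem _ _ (hfS j)
    have h2 := sub_mem (smul_mem _ D (hcomb a)) (smul_mem _ m (hcomb b))
    rw [smul_sub, smul_sub, ← map_smul, ← map_smul, sub_sub_sub_comm, ← map_sub, hzero,
      sub_zero] at h2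
    exact h2
  have hbN : ∑ j, b j • f j ∈ primFrac K (Set.univ : Set σ) :=
    sum_mem fun j _ => smul_mem _ _ (hf j)
  have hlast : D • z - ∑ j, b j • f j ∈ sumPrimFrac K L := by
    refine mem_sumPrimFrac_of_smul_mem hL hm (sub_mem (smul_mem _ _ hz) hbN) ?_
    have h3 : m • (D • z - ∑ j, b j • f j) =
        D • s + (D • ∑ j, a j • f j - m • ∑ j, b j • f j) := by
      rw [smul_sub, smul_comm m D z, ← hst, smul_add, add_sub_assoc]
    rw [h3]
    exact add_mem (smul_mem _ _ hs) hy
  rw [← sub_add_cancel (D • z) (∑ j, b j • f j)]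
  exact add_mem (mem_sup_left hlast)
    (mem_sup_right ((mem_span_range_iff_exists_fun ℤ).2 ⟨b, rfl⟩))

end

section

open MvPolynomial Submodule

variable {σ : Type u} {K : Type*} [Field K] [Algebra (MvPolynomial σ ℤ) K]
  [IsFractionRing (MvPolynomial σ ℤ) K]

/-! ### Freeness -/

theorem countable_primFrac {W : Set σ} (hW : W.Countable) : (primFrac K W : Set K).Countable := by
  have := hW.to_subtype
  have hs : (supported ℤ W : Set (MvPolynomial σ ℤ)).Countable := by
    rw [supported_eq_range_rename, AlgHom.coe_range]
    have : Countable (MvPolynomial W ℤ) := by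
      rw [← Cardinal.mk_le_aleph0_iff]
      exact cardinalMk_le_max_lift.trans (by simp)
    exact Set.countable_range _
  refine (hs.image2 hs (frac K)).mono ?_
  rintro _ ⟨p, hp, q, hq, -, rfl⟩
  exact ⟨p, hp, q, hq, rfl⟩

/-- Continuity of `primFrac`: an element involves only finitely many variables. -/
theorem primFrac_iUnion {ι : Type*} [LinearOrder ι] [Nonempty ι] {A : ι → Set σ}
    (hA : Monotone A) : primFrac K (⋃ i, A i) = ⨆ i, primFrac K (A i) := by
  classical
  refine le_antisymm ?_ (iSup_le fun i => primFrac_mono (Set.subset_iUnion A i))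
  rintro _ ⟨p, hp, q, hq, hqp, rfl⟩
  have hvars : ((p.vars ∪ q.vars : Finset σ) : Set σ) ⊆ ⋃ i, A i := by
    rw [Finset.coe_union]
    exact Set.union_subset (mem_supported.1 hp) (mem_supported.1 hq)
  obtain ⟨i, hi⟩ := hA.directed_le.exists_mem_subset_of_finset_subset_biUnion hvars
  rw [Finset.coe_union, Set.union_subset_iff] at hi
  exact mem_iSup_of_mem i ⟨p, mem_supported.2 hi.1, q, mem_supported.2 hi.2, hqp, rfl⟩

/-- A set of variables is the increasing union of initial segments of smaller cardinality, for a
well-order of minimal type. The relative groups of the steps of the resulting filtration are of the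
same form with a longer list `L`, so that induction on the cardinality applies. -/
theorem freeOver_primFrac (x₀ : σ) (W : Set σ) : ∀ L : List (Set σ), (∀ Y ∈ L, x₀ ∈ Y) →
    FreeOver (sumPrimFrac K L) (primFrac K (insert x₀ W)) := by
  induction hc : Cardinal.mk W using WellFoundedLT.induction generalizing W with
  | ind c ih =>
  subst hc
  intro L hL
  have huniv : primFrac K (insert x₀ W) ≤ primFrac K Set.univ := primFrac_mono (Set.subset_univ _)
  by_cases hcount : W.Countable
  · refine freeOver_of_countable (countable_primFrac (hcount.insert x₀))
      (fun m hm z hz => mem_sumPrimFrac_of_smul_mem hL hm (huniv hz)) fun k f hf => ?_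
    obtain ⟨D, hD, h⟩ := exists_bound_pureHull hL fun j => huniv (hf j)
    exact ⟨D, hD, fun z hz => h z (huniv hz)⟩
  obtain ⟨_, _, hord⟩ := Cardinal.exists_ord_eq_type_lt W
  have hinf : Cardinal.aleph0 ≤ Cardinal.mk W := by
    rw [Cardinal.aleph0_le_mk_iff]
    exact Set.infinite_coe_iff.2 fun h => hcount h.countable
  have hIio : ∀ i : W, Cardinal.mk ((↑) '' Set.Iio i : Set σ) < Cardinal.mk W := fun i =>
    Cardinal.mk_image_le.trans_lt (Cardinal.mk_Iio_lt i hord)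
  have hIic : ∀ i : W, Cardinal.mk ((↑) '' Set.Iic i : Set σ) < Cardinal.mk W := fun i => by
    rw [← Set.Iio_insert, Set.image_insert_eq]
    exact Cardinal.mk_insert_le.trans_lt
      (Cardinal.add_lt_of_lt hinf (hIio i) (Cardinal.one_lt_aleph0.trans_le hinf))
  let A : W → Set σ := fun i => insert x₀ ((↑) '' Set.Iic i)
  have hA : Monotone A := fun i j hij =>
    Set.insert_subset_insert (Set.image_mono (Set.Iic_subset_Iic.2 hij))
  have hne : Nonempty W := Cardinal.mk_ne_zero_iff.1 (Cardinal.aleph0_pos.trans_le hinf).ne'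
  have hW : insert x₀ W = ⋃ i, A i := by
    refine Set.Subset.antisymm (Set.insert_subset ?_ fun x hx => ?_) (Set.iUnion_subset fun i =>
      Set.insert_subset_insert ?_)
    · exact Set.mem_iUnion.2 ⟨hne.some, Set.mem_insert _ _⟩
    · exact Set.mem_iUnion.2 ⟨⟨x, hx⟩, Or.inr ⟨⟨x, hx⟩, le_rfl, rfl⟩⟩
    · rintro _ ⟨j, -, rfl⟩
      exact j.2
  have step : ∀ i : W, ∀ L : List (Set σ), (∀ Y ∈ L, x₀ ∈ Y) →
      FreeOver (sumPrimFrac K L) (primFrac K (A i)) := fun i => ih _ (hIic i) _ rfl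
  clear ih
  refine freeOver_of_filtration _ _ (fun i => primFrac K (A i))
    (fun i => ⨆ j : Set.Iio i, primFrac K (A j)) ?_
    (fun i j hj => le_iSup_of_le (⟨j, hj⟩ : Set.Iio i) le_rfl) (fun i => le_sup_right) fun i => ?_
  · rw [hW, primFrac_iUnion hA]
  rcases isEmpty_or_nonempty (Set.Iio i) with hi | hi
  · rw [iSup_of_empty, sup_bot_eq]
    exact step i L hL
  · have hL' : ∀ Y ∈ (⋃ j : Set.Iio i, A j) :: L, x₀ ∈ Y := by
      intro Y hY
      rcases List.mem_cons.1 hY with rfl | hY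
      · exact Set.mem_iUnion.2 ⟨hi.some, Set.mem_insert _ _⟩
      · exact hL Y hY
    have h1 : primFrac K (⋃ j : Set.Iio i, A j) = ⨆ j : Set.Iio i, primFrac K (A j) :=
      primFrac_iUnion fun j k hjk => hA hjk
    have h2 := step i _ hL'
    rw [sumPrimFrac_cons, h1, sup_comm] at h2
    exact h2

theorem free_RX (X : Type u) [Nonempty X] : Module.Free ℤ (RX X) := by
  obtain ⟨x₀⟩ := ‹Nonempty X›
  have h := (freeOver_primFrac (K := FractionRing (MvPolynomial X ℤ)) x₀ Set.univ []
    (by simp)).free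
  rw [Set.insert_eq_of_mem (Set.mem_univ x₀)] at h
  have hmem : ∀ z, z ∈ RX X ↔ z ∈ primFrac (FractionRing (MvPolynomial X ℤ)) (Set.univ : Set X) := by
    intro z
    constructor
    · rintro ⟨p, q, hq, rfl⟩
      exact frac_mem_primFrac_univ p hq
    · rintro ⟨p, -, q, -, hq, rfl⟩
      exact ⟨p, q, hq, rfl⟩
  let e : primFrac (FractionRing (MvPolynomial X ℤ)) (Set.univ : Set X) ≃+ RX X :=
    { toFun := fun z => ⟨z, (hmem z).2 z.2⟩
      invFun := fun z => ⟨z, (hmem z).1 z.2⟩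
      left_inv := fun _ => rfl
      right_inv := fun _ => rfl
      map_add' := fun _ _ => rfl }
  exact Module.Free.of_equiv e.toIntLinearEquiv

/-! ### The Noetherian property and the cardinality -/

/-- Every element of `RX X` is an integer times a unit. -/
theorem exists_eq_intCast_mul_unit {X : Type*} (z : RX X) :
    ∃ (c : ℤ) (u : (RX X)ˣ), z = c * u := by
  obtain ⟨z, p, q, hq, rfl⟩ := z
  by_cases hp : p = 0
  · exact ⟨0, 1, Subtype.ext (by simp [hp])⟩
  obtain ⟨c, r, hr, rfl⟩ := exists_eq_C_mul_isPrimitive hp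
  have hq0 := algebraMap_ne_zero hq
  have hr0 := algebraMap_ne_zero hr
  refine ⟨c, ⟨⟨_, r, q, hq, rfl⟩, ⟨_, q, r, hr, rfl⟩, Subtype.ext ?_, Subtype.ext ?_⟩,
    Subtype.ext ?_⟩
  · exact (div_mul_div_cancel₀ hq0).trans (div_self hr0)
  · exact (div_mul_div_cancel₀ hr0).trans (div_self hq0)
  · simp [mul_div_assoc]

/-- Ideals of `RX X` are generated by integers. -/
theorem isNoetherianRing_RX (X : Type*) : IsNoetherianRing (RX X) := by
  have : IsPrincipalIdealRing (RX X) := ⟨fun I => by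
    obtain ⟨n, hn⟩ := IsPrincipalIdealRing.principal (I.comap (Int.castRingHom (RX X)))
    refine ⟨(n : RX X), le_antisymm (fun z hz => ?_) ?_⟩
    · obtain ⟨c, u, rfl⟩ := exists_eq_intCast_mul_unit z
      have hc : c ∈ I.comap (Int.castRingHom (RX X)) :=
        (Ideal.mul_unit_mem_iff_mem I u.isUnit).1 hz
      rw [hn] at hc
      obtain ⟨d, rfl⟩ := Ideal.mem_span_singleton.1 hc
      exact Ideal.mem_span_singleton.2 ⟨d * u, by push_cast; ring⟩
    · have h1 : n ∈ I.comap (Int.castRingHom (RX X)) := by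
        rw [hn]; exact Ideal.mem_span_singleton_self n
      exact (Ideal.span_singleton_le_iff_mem I).2 h1⟩
  infer_instance

theorem mk_RX (X : Type u) [Infinite X] : Cardinal.mk (RX X) = Cardinal.mk X := by
  have hX := Cardinal.aleph0_le_mk X
  apply le_antisymm
  · refine (Cardinal.mk_subtype_le _).trans ?_
    rw [Cardinal.mk_fractionRing, MvPolynomial.cardinalMk_eq_max_lift]
    simp [hX]
  · refine Cardinal.mk_le_of_injective (f := fun x => (⟨algebraMap (MvPolynomial X ℤ) _ (MvPolynomial.X x),
      MvPolynomial.X x, 1, isPrimitive_one, by simp⟩ : RX X)) fun x y hxy => ?_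
    exact X_injective (IsFractionRing.injective _ (FractionRing (MvPolynomial X ℤ))
      (congrArg Subtype.val hxy))

end

end FreeNoetherian

theorem theorem217p1 (κ : Cardinal.{u}) (hκ : Cardinal.aleph0 ≤ κ) :
    (∃ (R : Type u) (_ : CommRing R),
      IsDomain R ∧ IsNoetherianRing R ∧ Module.Free ℤ R ∧ Cardinal.mk R = κ) ∧
    (∀ X : Type u, Cardinal.mk X = κ →
      IsDomain (FreeNoetherian.RX X) ∧ IsNoetherianRing (FreeNoetherian.RX X) ∧
        Module.Free ℤ (FreeNoetherian.RX X) ∧ Cardinal.mk (FreeNoetherian.RX X) = κ) := by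
  have key : ∀ X : Type u, Cardinal.mk X = κ →
      IsDomain (FreeNoetherian.RX X) ∧ IsNoetherianRing (FreeNoetherian.RX X) ∧
        Module.Free ℤ (FreeNoetherian.RX X) ∧ Cardinal.mk (FreeNoetherian.RX X) = κ := by
    rintro X rfl
    have : Infinite X := Cardinal.aleph0_le_mk_iff.1 hκ
    exact ⟨inferInstance, FreeNoetherian.isNoetherianRing_RX X, FreeNoetherian.free_RX X,
      FreeNoetherian.mk_RX X⟩
  exact ⟨⟨FreeNoetherian.RX κ.out, inferInstance, key κ.out κ.mk_out⟩, key⟩
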